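/- Let $G$ be a finite group. For $x,y\in G$ write $x\equiv_{\mathrm m}y$ if $x$ and $y$ lie in exactly the same maximal subgroups of $G$. For a positive integer $r$ write $x\equiv_{\mathrm m}^{(r)}y$ if, for all $z_1,\dots,z_{r-1}\in G$, one has $\langle x,z_1,\dots,z_{r-1}\rangle=G$ if and only if $\langle y,z_1,\dots,z_{r-1}\rangle=G$. Let $\psi(G)$ be the least positive integer $r$ such that the relations $\equiv_{\mathrm m}^{(r)}$ and $\equiv_{\mathrm m}$ on $G$ coincide, and let $\mu(G)$ be the maximum size of a minimal generating set of $G$, that is, of a generating set of $G$ no proper subset of which generates $G$. **Proposition.** For every nontrivial finite group $G$, $\psi(G)\le\mu(G)$. Moreover, for $p$ prime, $\psi(\mathrm{PSL}_2(p))\le 3$ if $p\notin\{7,11,19,31\}$, and $\psi(\mathrm{PSL}_2(p))\le 4$ if $p\in\{7,11,19,31\}$. -/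

import Mathlib

namespace GeneratorSubstitution

/-- `x ≡ₘ y`: the elements `x` and `y` lie in exactly the same maximal subgroups of `G`. -/
def MEquiv {G : Type*} [Group G] (x y : G) : Prop :=
  ∀ M : Subgroup G, IsCoatom M → (x ∈ M ↔ y ∈ M)

/-- `x ≡ₘ⁽ʳ⁾ y`, for a positive integer `r`: for all `z₁, …, z_{r-1}` in `G`,
`⟨x, z₁, …, z_{r-1}⟩ = G` if and only if `⟨y, z₁, …, z_{r-1}⟩ = G`. -/
def MEquivR {G : Type*} [Group G] (r : ℕ) (x y : G) : Prop :=
  ∀ z : Fin (r - 1) → G,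
    Subgroup.closure (insert x (Set.range z)) = ⊤ ↔
      Subgroup.closure (insert y (Set.range z)) = ⊤

/-- The positive integers `r` for which `≡ₘ⁽ʳ⁾` coincides with `≡ₘ`. -/
def stableIndices (G : Type*) [Group G] : Set ℕ :=
  {r | 0 < r ∧ ∀ x y : G, MEquivR r x y ↔ MEquiv x y}

/-- `ψ(G)`: the least positive integer `r` for which `≡ₘ⁽ʳ⁾` coincides with `≡ₘ`
(see `psi_isLeast`). -/
noncomputable def psi (G : Type*) [Group G] : ℕ := sInf (stableIndices G)

/-- A generating set of `G` no proper subset of which generates `G`. -/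
def IsMinimalGeneratingSet {G : Type*} [Group G] (S : Set G) : Prop :=
  Subgroup.closure S = ⊤ ∧ ∀ T : Set G, T ⊂ S → Subgroup.closure T ≠ ⊤

/-- The sizes of the minimal generating sets of `G`. -/
def minimalGeneratingSizes (G : Type*) [Group G] : Set ℕ :=
  {n | ∃ S : Set G, IsMinimalGeneratingSet S ∧ S.ncard = n}

/-- `μ(G)`: the maximum size of a minimal generating set of `G` (see `mu_isGreatest`). -/
noncomputable def mu (G : Type*) [Group G] : ℕ := sSup (minimalGeneratingSizes G)

theorem MEquiv.symm {G : Type*} [Group G] {x y : G} (h : MEquiv x y) : MEquiv y x :=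
  fun M hM => (h M hM).symm

theorem MEquiv.closure_insert_eq_top {G : Type*} [Group G] [Finite G] {x y : G}
    (h : MEquiv x y) {Z : Set G} (hx : Subgroup.closure (insert x Z) = ⊤) :
    Subgroup.closure (insert y Z) = ⊤ := by
  rcases eq_top_or_exists_le_coatom (Subgroup.closure (insert y Z)) with hy | ⟨M, hM, hle⟩
  · exact hy
  · rw [Subgroup.closure_le] at hle
    have hxM : x ∈ M := (h M hM).2 (hle (Set.mem_insert y Z))
    have hZ : Subgroup.closure (insert x Z) ≤ M := by
      rw [Subgroup.closure_le]
      exact Set.insert_subset hxM ((Set.subset_insert y Z).trans hle)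
    rw [hx] at hZ
    exact absurd (top_le_iff.1 hZ) hM.1

theorem MEquivR.mem_of_mem {G : Type*} [Group G] [Finite G] {x y : G}
    (h : MEquivR (Nat.card G + 1) x y) {M : Subgroup G} (hM : IsCoatom M) (hy : y ∈ M) :
    x ∈ M := by
  classical
  by_contra hx
  let e : Fin (Nat.card G) ≃ G := (Finite.equivFin G).symm
  let z : Fin (Nat.card G + 1 - 1) → G := fun i => if e i ∈ M then e i else 1
  have hz : Set.range z = (M : Set G) := by
    ext g
    constructor
    · rintro ⟨i, rfl⟩
      by_cases hi : e i ∈ M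
      · simp [z, hi]
      · simp [z, hi]
    · intro hg
      have hg' : g ∈ M := hg
      exact ⟨e.symm g, by simp [z, hg']⟩
  have h1 : Subgroup.closure (insert x (Set.range z)) = ⊤ := by
    rw [hz]
    refine hM.2 _ (lt_of_le_of_ne ?_ ?_)
    · intro g hg
      exact Subgroup.subset_closure (Set.mem_insert_of_mem x hg)
    · intro heq
      apply hx
      rw [heq]
      exact Subgroup.subset_closure (Set.mem_insert x _)
  have h2 := (h z).1 h1
  have h3 : Subgroup.closure (insert y (Set.range z)) ≤ M := by
    rw [Subgroup.closure_le, hz]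
    exact Set.insert_subset hy subset_rfl
  rw [h2] at h3
  exact hM.1 (top_le_iff.1 h3)

/-- For a finite group the relations do stabilise, so that `ψ(G)` is a genuine minimum. -/
theorem psi_isLeast (G : Type*) [Group G] [Finite G] : IsLeast (stableIndices G) (psi G) := by
  have hne : (stableIndices G).Nonempty := by
    refine ⟨Nat.card G + 1, Nat.succ_pos _, fun x y => ⟨fun h M hM => ⟨?_, ?_⟩, fun h z => ?_⟩⟩
    · exact MEquivR.mem_of_mem (fun z => (h z).symm) hM
    · exact MEquivR.mem_of_mem h hM
    · exact ⟨h.closure_insert_eq_top, h.symm.closure_insert_eq_top⟩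
  exact ⟨Nat.sInf_mem hne, fun n hn => Nat.sInf_le hn⟩

/-- For a finite group the maximum in the definition of `μ(G)` exists. -/
theorem mu_isGreatest (G : Type*) [Group G] [Finite G] :
    IsGreatest (minimalGeneratingSizes G) (mu G) := by
  have hne : (minimalGeneratingSizes G).Nonempty := by
    have hfin : ({S : Set G | Subgroup.closure S = ⊤}).Finite := Set.toFinite _
    obtain ⟨S, hS⟩ := hfin.exists_minimal ⟨Set.univ, Subgroup.closure_univ⟩
    exact ⟨S.ncard, S, ⟨hS.1, fun T hT hT' => hT.2 (hS.2 hT' hT.1)⟩, rfl⟩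
  have hbdd : BddAbove (minimalGeneratingSizes G) := by
    refine ⟨Nat.card G, ?_⟩
    rintro n ⟨S, -, rfl⟩
    exact Set.ncard_le_card S
  exact ⟨Nat.sSup_mem hne hbdd, fun n hn => le_csSup hbdd hn⟩

end GeneratorSubstitution

open MulAction Matrix Polynomial

/-! Both bounds rest on one criterion: `psi G ≤ r` as soon as, for every maximal subgroup M and
every x outside M, some r - 1 elements of M generate G together with x. If y lies in M and x does
not, such elements separate x from y.

For the bound by `mu`, take Z ⊆ M minimal with ⟨x, Z⟩ = G. No element of Z can be dropped, nor can
x, since Z lies in M; so Z ∪ {x} is a minimal generating set and |Z| ≤ `mu G` - 1.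

For PSL₂(p), every subgroup is 2-generated, which gives the bound 3 for all primes at once,
including 7, 11, 19, 31. Lift the subgroup to K ≤ SL₂(p). If p divides |K|, then K contains a
transvection up to conjugacy in the standard form; either K is triangular, hence unipotent by
cyclic, or K is the whole of SL₂(p). If p does not divide |K|, each element of K acting nontrivially
on the projective line over the field of p² elements has exactly two fixed points, and point
stabilisers are cyclic. Klein's orbit count then allows only the cyclic, dihedral, tetrahedral,
octahedral and icosahedral patterns, and in each of them two elements suffice. -/

/-! ### Klein's orbit count for actions in which nontrivial elements fix two points -/

theorem sum_one_sub_inv_card_stabilizer {G X : Type*} [Group G] [Finite G] [MulAction G X]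
    [Finite X] (h : ∀ g : G, g ≠ 1 → Nat.card (fixedBy X g) = 2)
    [Fintype (orbitRel.Quotient G X)] :
    ∑ ω : orbitRel.Quotient G X, (1 - (Nat.card (stabilizer G ω.out) : ℚ)⁻¹) =
      2 - 2 / Nat.card G := by
  classical
  have := Fintype.ofFinite G
  have := Fintype.ofFinite X
  have hB := sum_card_fixedBy_eq_card_orbits_mul_card_group G X
  have hO := card_eq_sum_card_group_div_card_stabilizer G X
  rw [← Finset.add_sum_erase _ _ (Finset.mem_univ (1 : G))] at hB
  have h1 : Fintype.card (fixedBy X (1 : G)) = Fintype.card X := by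
    rw [← Nat.card_eq_fintype_card, ← Nat.card_eq_fintype_card, fixedBy_one_eq_univ,
      Nat.card_univ]
  have h2 : ∑ g ∈ Finset.univ.erase (1 : G), Fintype.card (fixedBy X g) =
      2 * (Fintype.card G - 1) := by
    rw [Finset.sum_congr rfl (g := fun _ => 2), Finset.sum_const,
      Finset.card_erase_of_mem (Finset.mem_univ _), Finset.card_univ, smul_eq_mul, mul_comm]
    intro g hg
    rw [← Nat.card_eq_fintype_card]
    exact h g (Finset.ne_of_mem_erase hg)
  have hpos : 0 < Fintype.card G := Fintype.card_pos
  rw [h1, h2] at hB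
  -- Burnside's lemma: the identity fixes all of X, every other element fixes two points. Comparing
  -- with the orbit decomposition of |X| below gives the formula.
  have hB' : (Fintype.card X : ℚ) + 2 * (Fintype.card G - 1) =
      Fintype.card (orbitRel.Quotient G X) * Fintype.card G := by
    have := congrArg (Nat.cast : ℕ → ℚ) hB
    push_cast [Nat.cast_sub (Nat.one_le_iff_ne_zero.2 hpos.ne')] at this
    exact this
  have hO' : (Fintype.card X : ℚ) =
      ∑ ω : orbitRel.Quotient G X, (Fintype.card G : ℚ) *
        (Nat.card (stabilizer G ω.out) : ℚ)⁻¹ := by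
    rw [hO, Nat.cast_sum]
    refine Finset.sum_congr rfl fun ω _ => ?_
    rw [Nat.cast_div, Nat.card_eq_fintype_card, div_eq_mul_inv]
    · rw [← Nat.card_eq_fintype_card, ← Nat.card_eq_fintype_card]
      exact Subgroup.card_subgroup_dvd_card _
    · exact_mod_cast Fintype.card_ne_zero
  rw [← Finset.mul_sum] at hO'
  rw [Finset.sum_sub_distrib, Finset.sum_const, Finset.card_univ, nsmul_eq_mul, mul_one,
    Nat.card_eq_fintype_card]
  have hq : (Fintype.card G : ℚ) ≠ 0 := by exact_mod_cast hpos.ne'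
  rw [hO'] at hB'
  generalize ∑ ω : orbitRel.Quotient G X, (Nat.card (stabilizer G ω.out) : ℚ)⁻¹ = s at hB' ⊢
  field_simp
  linarith

/-- The reciprocals must sum to more than 1, which forces a = 2 and b ≤ 3. The case b = 2 is the
dihedral family; b = 3 leaves c ≤ 5. -/
theorem platonic_triple {a b c n : ℕ} (ha : 2 ≤ a) (hab : a ≤ b) (hbc : b ≤ c) (hn : 2 ≤ n)
    (h : (a : ℚ)⁻¹ + (b : ℚ)⁻¹ + (c : ℚ)⁻¹ = 1 + 2 / n) :
    2 * c = n ∨ (a = 2 ∧ b = 3 ∧ (c = 3 ∧ n = 12 ∨ c = 4 ∧ n = 24 ∨ c = 5 ∧ n = 60)) := by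
  have hn0 : (0 : ℚ) < 2 / n := by positivity
  have hca : (c : ℚ)⁻¹ ≤ (b : ℚ)⁻¹ := by
    apply inv_anti₀
    · exact_mod_cast (by omega : 0 < b)
    · exact_mod_cast hbc
  have hba : (b : ℚ)⁻¹ ≤ (a : ℚ)⁻¹ := by
    apply inv_anti₀
    · exact_mod_cast (by omega : 0 < a)
    · exact_mod_cast hab
  have ha2 : a = 2 := by
    by_contra hne
    have : (a : ℚ)⁻¹ ≤ (3 : ℚ)⁻¹ := by
      apply inv_anti₀ (by norm_num)
      exact_mod_cast (by omega : 3 ≤ a)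
    linarith
  subst ha2
  have hb : b < 4 := by
    by_contra hne
    have : (b : ℚ)⁻¹ ≤ (4 : ℚ)⁻¹ := by
      apply inv_anti₀ (by norm_num)
      exact_mod_cast (by omega : 4 ≤ b)
    norm_num at h
    linarith
  have hcq : (c : ℚ) ≠ 0 := by exact_mod_cast (by omega : c ≠ 0)
  have hnq : (n : ℚ) ≠ 0 := by exact_mod_cast (by omega : n ≠ 0)
  obtain rfl | rfl : b = 2 ∨ b = 3 := by omega
  · left
    field_simp at h
    have : (2 * c : ℚ) = n := by push_cast at h; linarith
    exact_mod_cast this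
  · right
    have hc : c < 6 := by
      by_contra hne
      have : (c : ℚ)⁻¹ ≤ (6 : ℚ)⁻¹ := by
        apply inv_anti₀ (by norm_num)
        exact_mod_cast (by omega : 6 ≤ c)
      norm_num at h
      linarith
    refine ⟨rfl, rfl, ?_⟩
    obtain rfl | rfl | rfl : c = 3 ∨ c = 4 ∨ c = 5 := by omega
    · left
      field_simp at h
      have : (n : ℚ) = 12 := by push_cast at h; linarith
      exact ⟨rfl, by exact_mod_cast this⟩
    · right; left
      field_simp at h
      have : (n : ℚ) = 24 := by push_cast at h; linarith
      exact ⟨rfl, by exact_mod_cast this⟩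
    · right; right
      field_simp at h
      have : (n : ℚ) = 60 := by push_cast at h; linarith
      exact ⟨rfl, by exact_mod_cast this⟩

/-- Regular orbits contribute 0 and every other orbit a term in [1/2, 1), while the total lies in
[1, 2); so there are two or three nonregular orbits. Two force a global fixed point, three give a
platonic triple. -/
theorem stabilizer_order_cases {ι : Type*} [Fintype ι] {e : ι → ℕ} {n : ℕ} (hn : 2 ≤ n)
    (he : ∀ i, 0 < e i) (hen : ∀ i, e i ≤ n)
    (h : ∑ i, (1 - (e i : ℚ)⁻¹) = 2 - 2 / n) :
    (∃ i, e i = n) ∨ (∃ i, 2 * e i = n) ∨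
      (n = 12 ∧ (∀ i, e i ≤ 3) ∧ ∃ i, e i = 3) ∨
      (n = 24 ∧ (∀ i, e i ≤ 4) ∧ (∃ i, e i = 3) ∧ ∃ i, e i = 4) ∨
      (n = 60 ∧ (∀ i, e i ≤ 5) ∧ (∃ i, e i = 3) ∧ ∃ i, e i = 5) := by
  classical
  set S : Finset ι := Finset.univ.filter fun i => 2 ≤ e i with hS
  have hmem : ∀ i, i ∈ S ↔ 2 ≤ e i := by simp [hS]
  have hsum : ∑ i ∈ S, (1 - (e i : ℚ)⁻¹) = 2 - 2 / n := by
    rw [← h]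
    refine Finset.sum_subset (Finset.subset_univ _) fun i _ hi => ?_
    rw [hmem] at hi
    have : e i = 1 := by have := he i; omega
    simp [this]
  have hnq : (2 : ℚ) ≤ n := by exact_mod_cast hn
  have hn1 : 2 / (n : ℚ) ≤ 1 := by rw [div_le_one (by linarith)]; exact hnq
  have hn0 : 0 < 2 / (n : ℚ) := by positivity
  have hlow : (S.card : ℚ) * 2⁻¹ ≤ 2 - 2 / n := by
    rw [← hsum, ← nsmul_eq_mul]
    refine Finset.card_nsmul_le_sum _ _ _ fun i hi => ?_
    have : (e i : ℚ)⁻¹ ≤ (2 : ℚ)⁻¹ := by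
      apply inv_anti₀ (by norm_num)
      exact_mod_cast (hmem i).1 hi
    linarith
  have hterm : ∀ i, (1 - (e i : ℚ)⁻¹) < 1 := fun i => by
    have : 0 < (e i : ℚ)⁻¹ := by have := he i; positivity
    linarith
  have h3 : S.card ≤ 3 := by
    have : (S.card : ℚ) < 4 := by linarith
    have : S.card < 4 := by exact_mod_cast this
    omega
  have h2 : 2 ≤ S.card := by
    by_contra hlt
    rcases (by omega : S.card = 0 ∨ S.card = 1) with h0 | h0
    · rw [Finset.card_eq_zero] at h0
      rw [h0, Finset.sum_empty] at hsum
      linarith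
    · obtain ⟨i, hi⟩ := Finset.card_eq_one.1 h0
      rw [hi, Finset.sum_singleton] at hsum
      have := hterm i
      linarith
  rcases (by omega : S.card = 2 ∨ S.card = 3) with hc | hc
  · obtain ⟨i, j, hij, hSij⟩ := Finset.card_eq_two.1 hc
    rw [hSij, Finset.sum_pair hij] at hsum
    left
    refine ⟨i, le_antisymm (hen i) ?_⟩
    have hj : (n : ℚ)⁻¹ ≤ (e j : ℚ)⁻¹ := by
      apply inv_anti₀
      · exact_mod_cast he j
      · exact_mod_cast hen j
    have hi : (e i : ℚ)⁻¹ ≤ (n : ℚ)⁻¹ := by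
      rw [div_eq_mul_inv] at hsum
      linarith
    rw [inv_le_inv₀ (by exact_mod_cast he i) (by linarith)] at hi
    exact_mod_cast hi
  · have key : ∀ i j k, i ≠ j → i ≠ k → j ≠ k → S = {i, j, k} → e i ≤ e j → e j ≤ e k →
        ((∃ i, e i = n) ∨ (∃ i, 2 * e i = n) ∨
      (n = 12 ∧ (∀ i, e i ≤ 3) ∧ ∃ i, e i = 3) ∨
      (n = 24 ∧ (∀ i, e i ≤ 4) ∧ (∃ i, e i = 3) ∧ ∃ i, e i = 4) ∨
      (n = 60 ∧ (∀ i, e i ≤ 5) ∧ (∃ i, e i = 3) ∧ ∃ i, e i = 5)) := by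
      intro i j k hij hik hjk hSe h1 h2
      rw [hSe, Finset.sum_insert (by simp [hij, hik]), Finset.sum_pair hjk] at hsum
      have hi : 2 ≤ e i := (hmem i).1 (by simp [hSe])
      have hle : ∀ l, e l ≤ e k := by
        intro l
        by_cases hl : l ∈ S
        · rw [hSe] at hl
          simp only [Finset.mem_insert, Finset.mem_singleton] at hl
          rcases hl with rfl | rfl | rfl <;> omega
        · rw [hmem] at hl; omega
      rcases platonic_triple hi h1 h2 hn (by linarith) with h | ⟨-, hb, h | h | h⟩
      · exact Or.inr (Or.inl ⟨k, h⟩)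
      · exact Or.inr (Or.inr (Or.inl ⟨h.2, fun l => h.1 ▸ hle l, k, h.1⟩))
      · exact Or.inr (Or.inr (Or.inr (Or.inl ⟨h.2, fun l => h.1 ▸ hle l, ⟨j, hb⟩, k, h.1⟩)))
      · exact Or.inr (Or.inr (Or.inr (Or.inr ⟨h.2, fun l => h.1 ▸ hle l, ⟨j, hb⟩, k, h.1⟩)))
    obtain ⟨i, j, k, hij, hik, hjk, hSe⟩ := Finset.card_eq_three.1 hc
    rcases le_total (e i) (e j) with h1 | h1 <;> rcases le_total (e j) (e k) with h2 | h2 <;>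
      rcases le_total (e i) (e k) with h3 | h3
    · exact key i j k hij hik hjk hSe h1 h2
    · exact key i j k hij hik hjk hSe h1 h2
    · exact key i k j hik hij hjk.symm (by rw [hSe]; ext; simp; tauto) h3 h2
    · exact key k i j hik.symm hjk.symm hij (by rw [hSe]; ext; simp; tauto) h3 h1
    · exact key j i k hij.symm hjk hik (by rw [hSe]; ext; simp; tauto) h1 h3
    · exact key j k i hjk hij.symm hik.symm (by rw [hSe]; ext; simp; tauto) h2 h3
    · exact key k j i hjk.symm hik.symm hij.symm (by rw [hSe]; ext; simp; tauto) h2 h1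
    · exact key k j i hjk.symm hik.symm hij.symm (by rw [hSe]; ext; simp; tauto) h2 h1

theorem card_cases_of_card_fixedBy_eq_two {G X : Type*} [Group G] [Finite G] [MulAction G X]
    [Finite X] (h : ∀ g : G, g ≠ 1 → Nat.card (fixedBy X g) = 2) (hG : 2 ≤ Nat.card G) :
    (∃ x : X, Nat.card (stabilizer G x) = Nat.card G) ∨
      (∃ x : X, 2 * Nat.card (stabilizer G x) = Nat.card G) ∨
      (Nat.card G = 12 ∧ (∀ x : X, Nat.card (stabilizer G x) ≤ 3) ∧
        ∃ x : X, Nat.card (stabilizer G x) = 3) ∨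
      (Nat.card G = 24 ∧ (∀ x : X, Nat.card (stabilizer G x) ≤ 4) ∧
        (∃ x : X, Nat.card (stabilizer G x) = 3) ∧ ∃ x : X, Nat.card (stabilizer G x) = 4) ∨
      (Nat.card G = 60 ∧ (∀ x : X, Nat.card (stabilizer G x) ≤ 5) ∧
        (∃ x : X, Nat.card (stabilizer G x) = 3) ∧ ∃ x : X, Nat.card (stabilizer G x) = 5) := by
  classical
  have := Fintype.ofFinite (orbitRel.Quotient G X)
  have hx : ∀ x : X, Nat.card (stabilizer G x) =
      Nat.card (stabilizer G (Quotient.mk (orbitRel G X) x).out) := fun x =>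
    Nat.card_congr (stabilizerEquivStabilizerOfOrbitRel
      ((orbitRel G X).symm (Quotient.mk_out (s := orbitRel G X) x))).toEquiv
  have key := stabilizer_order_cases (e := fun ω : orbitRel.Quotient G X =>
    Nat.card (stabilizer G ω.out)) hG (fun _ => Nat.card_pos)
    (fun _ => Nat.le_of_dvd Nat.card_pos (Subgroup.card_subgroup_dvd_card _))
    (sum_one_sub_inv_card_stabilizer h)
  rcases key with ⟨i, hi⟩ | ⟨i, hi⟩ | ⟨h1, h2, i, hi⟩ | ⟨h1, h2, ⟨i, hi⟩, j, hj⟩ |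
    ⟨h1, h2, ⟨i, hi⟩, j, hj⟩
  · exact Or.inl ⟨_, hi⟩
  · exact Or.inr (Or.inl ⟨_, hi⟩)
  · exact Or.inr (Or.inr (Or.inl ⟨h1, fun x => (hx x).trans_le (h2 _), _, hi⟩))
  · exact Or.inr (Or.inr (Or.inr (Or.inl ⟨h1, fun x => (hx x).trans_le (h2 _), ⟨_, hi⟩, _, hj⟩)))
  · exact Or.inr (Or.inr (Or.inr (Or.inr ⟨h1, fun x => (hx x).trans_le (h2 _), ⟨_, hi⟩, _, hj⟩)))

/-- The generators are generators of suitable point stabilisers, except for a second element that is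
trivial in the cyclic case and arbitrary outside an index-2 stabiliser in the dihedral case. -/
theorem exists_closure_pair_eq_top_of_card_fixedBy_eq_two {G X : Type*} [Group G] [Finite G]
    [MulAction G X] [Finite X] (h : ∀ g : G, g ≠ 1 → Nat.card (fixedBy X g) = 2)
    (hcyc : ∀ x : X, IsCyclic (stabilizer G x)) :
    ∃ a b : G, Subgroup.closure {a, b} = ⊤ := by
  have hgen : ∀ x : X, ∃ a : G, Subgroup.zpowers a = stabilizer G x := fun x =>
    (Subgroup.isCyclic_iff_exists_zpowers_eq_top _).1 (hcyc x)
  have hle : ∀ {a b : G}, Subgroup.zpowers a ≤ Subgroup.closure {a, b} := fun {a b} => by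
    rw [Subgroup.zpowers_le]; exact Subgroup.subset_closure (by simp)
  have hle' : ∀ {a b : G}, Subgroup.zpowers b ≤ Subgroup.closure {a, b} := fun {a b} => by
    rw [Subgroup.zpowers_le]; exact Subgroup.subset_closure (by simp)
  have hK : ∀ K : Subgroup G, ∀ k : K, k ≠ 1 → Nat.card (fixedBy X k) = 2 := fun K k hk =>
    h k (by simpa using hk)
  have hKs : ∀ (K : Subgroup G) (x : X),
      Nat.card (stabilizer K x) ≤ Nat.card (stabilizer G x) := fun K x =>
    Nat.card_le_card_of_injective
      (fun k : stabilizer K x => (⟨k.1.1, k.2⟩ : stabilizer G x))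
      fun a b hab => by
        exact Subtype.ext (Subtype.ext (congrArg (fun k : stabilizer G x => (k : G)) hab))
  rcases (Nat.one_le_iff_ne_zero.2 (Nat.card_pos (α := G)).ne').eq_or_lt with h1 | hG
  · have := (Nat.card_eq_one_iff_unique.1 h1.symm).1
    exact ⟨1, 1, Subsingleton.elim _ _⟩
  have hdvd : ∀ x : X, ∀ K : Subgroup G, stabilizer G x ≤ K →
      Nat.card (stabilizer G x) ∣ Nat.card K := fun x K => Subgroup.card_dvd_of_le
  rcases card_cases_of_card_fixedBy_eq_two h hG with ⟨x, hx⟩ | ⟨x, hx⟩ | ⟨h1, h2, x, hx⟩ |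
    ⟨h1, h2, ⟨x, hx⟩, y, hy⟩ | ⟨h1, h2, ⟨x, hx⟩, y, hy⟩
  · obtain ⟨a, ha⟩ := hgen x
    refine ⟨a, 1, top_le_iff.1 (le_trans ?_ hle)⟩
    rw [ha, Subgroup.eq_top_of_card_eq _ hx]
  · obtain ⟨a, ha⟩ := hgen x
    have : ∃ b, b ∉ stabilizer G x := by
      by_contra! hall
      rw [(Subgroup.eq_top_iff' _).2 hall, Subgroup.card_top] at hx
      omega
    obtain ⟨b, hb⟩ := this
    refine ⟨a, b, ?_⟩
    have hsub : stabilizer G x ≤ Subgroup.closure {a, b} := ha ▸ hle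
    have hbm : b ∈ Subgroup.closure {a, b} := Subgroup.subset_closure (by simp)
    apply Subgroup.eq_top_of_card_eq
    have hpos : 0 < Nat.card (stabilizer G x) := Nat.card_pos
    obtain ⟨m, hm⟩ := hdvd x _ hsub
    have hm1 : m ≠ 1 := by
      rintro rfl
      rw [mul_one] at hm
      exact hb ((Subgroup.eq_of_le_of_card_ge hsub hm.le) ▸ hbm)
    have hm2 : m ∣ 2 := by
      have := Subgroup.card_subgroup_dvd_card (Subgroup.closure {a, b})
      rw [hm, ← hx, mul_comm 2] at this
      exact Nat.dvd_of_mul_dvd_mul_left hpos this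
    rcases (Nat.dvd_prime Nat.prime_two).1 hm2 with h' | h'
    · exact absurd h' hm1
    · rw [hm, h', ← hx, mul_comm]
  · obtain ⟨a, ha⟩ := hgen x
    have ha1 : a ≠ 1 := by
      rintro rfl
      rw [Subgroup.zpowers_one_eq_bot] at ha
      rw [← ha, Subgroup.card_bot] at hx
      omega
    have hox : Nat.card (orbit G x) = 4 := by
      have := Nat.card_congr (orbitProdStabilizerEquivGroup G x)
      rw [Nat.card_prod, hx, h1] at this
      omega
    -- The orbit has four points and a fixes only two. The stabilisers of x and y then meet
    -- trivially, so they generate at least 3 · 3 elements, more than half of 12.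
    have : ∃ y ∈ orbit G x, y ∉ fixedBy X a := by
      by_contra! hall
      have := Nat.card_mono (Set.toFinite _) hall
      rw [h a ha1] at this
      omega
    obtain ⟨y, hyo, hya⟩ := this
    have hy : Nat.card (stabilizer G y) = 3 := by
      rw [← hx]
      exact Nat.card_congr (stabilizerEquivStabilizerOfOrbitRel hyo).toEquiv
    obtain ⟨b, hb⟩ := hgen y
    refine ⟨a, b, ?_⟩
    have hsx : stabilizer G x ≤ Subgroup.closure {a, b} := ha ▸ hle
    have hsy : stabilizer G y ≤ Subgroup.closure {a, b} := hb ▸ hle'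
    have hdis : Disjoint (stabilizer G x) (stabilizer G y) := by
      rw [disjoint_iff]
      have hd := Subgroup.card_dvd_of_le (inf_le_left : stabilizer G x ⊓ stabilizer G y ≤ _)
      rw [hx] at hd
      rcases (Nat.dvd_prime Nat.prime_three).1 hd with h' | h'
      · exact Subgroup.card_eq_one.1 h'
      · exfalso
        have := Subgroup.eq_of_le_of_card_ge
          (inf_le_left : stabilizer G x ⊓ stabilizer G y ≤ _) (by rw [hx, h'])
        have hax : a ∈ stabilizer G x := ha ▸ Subgroup.mem_zpowers a
        rw [← this] at hax
        exact hya hax.2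
    have hinj := Subgroup.mul_injective_of_disjoint hdis
    have h9 : 9 ≤ Nat.card (Subgroup.closure {a, b}) := by
      have := Nat.card_le_card_of_injective
        (fun g : stabilizer G x × stabilizer G y =>
          (⟨g.1 * g.2, mul_mem (hsx g.1.2) (hsy g.2.2)⟩ : Subgroup.closure {a, b}))
        fun u v huv => hinj (congrArg Subtype.val huv)
      rw [Nat.card_prod, hx, hy] at this
      omega
    apply Subgroup.eq_top_of_card_eq
    obtain ⟨m, hm⟩ := Subgroup.card_subgroup_dvd_card (Subgroup.closure {a, b})
    rw [h1] at hm ⊢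
    have : m < 2 := by nlinarith
    interval_cases m <;> omega
  · obtain ⟨a, ha⟩ := hgen x
    obtain ⟨b, hb⟩ := hgen y
    refine ⟨a, b, Subgroup.eq_top_of_card_eq _ ?_⟩
    have hdx := hdvd x _ (ha ▸ hle : stabilizer G x ≤ Subgroup.closure {a, b})
    have hsy : stabilizer G y ≤ Subgroup.closure {a, b} := hb ▸ hle'
    have hdy := hdvd y _ hsy
    rw [hx] at hdx
    rw [hy] at hdy
    have hyK : 4 ≤ Nat.card (stabilizer (Subgroup.closure {a, b}) y) := by
      rw [← hy]
      exact Nat.card_le_card_of_injective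
        (fun g : stabilizer G y => (⟨⟨g, hsy g.2⟩, g.2⟩ :
          stabilizer (Subgroup.closure {a, b}) y))
        fun u v huv => Subtype.ext (congrArg (fun k => k.1.1) huv)
    have hpos : 0 < Nat.card (Subgroup.closure {a, b}) := Nat.card_pos
    -- The orbit count applied to the generated subgroup itself: its order is a multiple of 12, and
    -- order 12 is impossible because it would need a stabiliser of order at least 6, or all
    -- stabilisers of order at most 3 although y has one of order 4.
    rcases card_cases_of_card_fixedBy_eq_two (hK (Subgroup.closure {a, b})) (by omega) with
      ⟨z, hz⟩ | ⟨z, hz⟩ | ⟨-, hz, -⟩ | ⟨hz, -⟩ | ⟨hz, -⟩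
    · have := (hKs (Subgroup.closure {a, b}) z).trans (h2 z)
      omega
    · have := (hKs (Subgroup.closure {a, b}) z).trans (h2 z)
      omega
    · have := hz y
      omega
    · omega
    · have := Subgroup.card_le_card_group (Subgroup.closure {a, b})
      omega
  · obtain ⟨a, ha⟩ := hgen x
    obtain ⟨b, hb⟩ := hgen y
    refine ⟨a, b, Subgroup.eq_top_of_card_eq _ ?_⟩
    have hdx := hdvd x _ (ha ▸ hle : stabilizer G x ≤ Subgroup.closure {a, b})
    have hdy := hdvd y _ (hb ▸ hle' : stabilizer G y ≤ Subgroup.closure {a, b})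
    rw [hx] at hdx
    rw [hy] at hdy
    have hpos : 0 < Nat.card (Subgroup.closure {a, b}) := Nat.card_pos
    -- The order is a multiple of 15, and stabilisers have order at most 5, so only the pattern of
    -- order 60 survives.
    rcases card_cases_of_card_fixedBy_eq_two (hK (Subgroup.closure {a, b})) (by omega) with
      ⟨z, hz⟩ | ⟨z, hz⟩ | ⟨hz, -⟩ | ⟨hz, -⟩ | ⟨hz, -⟩
    · have := (hKs (Subgroup.closure {a, b}) z).trans (h2 z)
      omega
    · have := (hKs (Subgroup.closure {a, b}) z).trans (h2 z)
      omega
    · omega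
    · omega
    · omega

/-! ### Fixed points of Möbius transformations -/

theorem exists_root_quadratic_galoisField (p : ℕ) [Fact p.Prime] {a b c : ZMod p} (ha : a ≠ 0) :
    ∃ x : GaloisField p 2, algebraMap _ (GaloisField p 2) a * x ^ 2 +
      algebraMap _ (GaloisField p 2) b * x + algebraMap _ (GaloisField p 2) c = 0 := by
  set f : (ZMod p)[X] := C a * X ^ 2 + C b * X + C c with hf
  have hdeg : f.natDegree = 2 := natDegree_quadratic ha
  have hf0 : f ≠ 0 := by rintro h; rw [h, natDegree_zero] at hdeg; omega
  suffices ∃ x : GaloisField p 2, aeval x f = 0 by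
    obtain ⟨x, hx⟩ := this
    exact ⟨x, by simpa [hf] using hx⟩
  by_cases hirr : Irreducible f
  · have := Fact.mk hirr
    have := (AdjoinRoot.powerBasis hf0).finite
    have hfr : Module.finrank (ZMod p) (AdjoinRoot f) = 2 := by
      rw [(AdjoinRoot.powerBasis hf0).finrank, AdjoinRoot.powerBasis_dim, hdeg]
    have : Module.finrank (ZMod p) (AdjoinRoot f) ∣
        Module.finrank (ZMod p) (GaloisField p 2) := by
      rw [hfr, GaloisField.finrank p two_ne_zero]
    obtain ⟨φ⟩ := FiniteField.nonempty_algHom_of_finrank_dvd this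
    exact ⟨φ (AdjoinRoot.root f), by
      rw [aeval_algHom_apply, AdjoinRoot.aeval_eq, AdjoinRoot.mk_self, map_zero]⟩
  · rw [irreducible_iff_roots_eq_zero_of_degree_le_three hdeg.ge (by omega)] at hirr
    obtain ⟨r, hr⟩ := Multiset.exists_mem_of_ne_zero hirr
    rw [mem_roots hf0, IsRoot.def] at hr
    exact ⟨algebraMap _ _ r, by rw [aeval_algebraMap_apply, coe_aeval_eq_eval, hr, map_zero]⟩

theorem card_fixedBy_onePoint_eq_two {F : Type*} [Field F] [DecidableEq F] (g : GL (Fin 2) F)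
    (hdisc : (g 0 0 - g 1 1) ^ 2 + 4 * (g 0 1 * g 1 0) ≠ 0)
    (hroot : g 1 0 ≠ 0 → ∃ x, g 1 0 * x ^ 2 + (g 1 1 - g 0 0) * x - g 0 1 = 0) :
    Nat.card (fixedBy (OnePoint F) g) = 2 := by
  have hfin : ∀ x : F, (x : OnePoint F) ∈ fixedBy (OnePoint F) g ↔
      g 1 0 * x ^ 2 + (g 1 1 - g 0 0) * x - g 0 1 = 0 := fun x => by
    rw [mem_fixedBy, ← GeneralLinearGroup.fixpointPolynomial_aeval_eq_zero_iff]
    simp [GeneralLinearGroup.fixpointPolynomial]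
  have hinf : OnePoint.infty ∈ fixedBy (OnePoint F) g ↔ g 1 0 = 0 := by
    rw [mem_fixedBy, OnePoint.smul_infty_eq_self_iff]
  rw [Nat.card_coe_set_eq, Set.ncard_eq_two]
  by_cases hc : g 1 0 = 0
  · rw [hc, mul_zero, mul_zero, add_zero] at hdisc
    have had : g 1 1 - g 0 0 ≠ 0 := by
      intro h
      exact hdisc (by rw [← neg_sub, h]; ring)
    refine ⟨OnePoint.infty, ((g 0 1 / (g 1 1 - g 0 0) : F) : OnePoint F),
      OnePoint.infty_ne_coe _, ?_⟩
    ext y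
    cases y with
    | infty => simp [hinf, hc]
    | coe y =>
      rw [hfin, hc]
      simp only [Set.mem_insert_iff, OnePoint.coe_ne_infty, Set.mem_singleton_iff,
        OnePoint.coe_eq_coe, false_or, eq_div_iff had]
      constructor <;> intro h <;> linear_combination h
  · obtain ⟨x, hx⟩ := hroot hc
    -- The second root comes from Vieta; it differs from x because the discriminant is nonzero.
    refine ⟨x, (((g 0 0 - g 1 1) / g 1 0 - x : F) : OnePoint F), ?_, ?_⟩
    · rw [Ne, OnePoint.coe_eq_coe]
      intro h
      have h' : 2 * g 1 0 * x = g 0 0 - g 1 1 := by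
        field_simp at h
        linear_combination h
      apply hdisc
      linear_combination (2 * g 1 0 * x + (g 1 1 - g 0 0)) * h' - (4 * g 1 0) * hx
    · ext y
      cases y with
      | infty => simp [hinf, hc]
      | coe y =>
        rw [hfin]
        simp only [Set.mem_insert_iff, Set.mem_singleton_iff, OnePoint.coe_eq_coe]
        have key : g 1 0 * y ^ 2 + (g 1 1 - g 0 0) * y - g 0 1 =
            g 1 0 * ((y - x) * (y - ((g 0 0 - g 1 1) / g 1 0 - x))) := by
          field_simp
          linear_combination hx
        rw [key, mul_eq_zero, mul_eq_zero, sub_eq_zero, sub_eq_zero]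
        simp [hc]

/-! ### Subgroups of SL₂(p) of order prime to p -/

section SL2

variable {p : ℕ} [Fact p.Prime]

/-- By Cayley–Hamilton (g - 1)² = 0, and g ^ p - 1 = (g - 1) ^ p in characteristic p. -/
theorem SL2_pow_char_eq_one_of_trace_eq_two {g : SpecialLinearGroup (Fin 2) (ZMod p)}
    (hg : g 0 0 + g 1 1 = 2) : g ^ p = 1 := by
  have hd : g 0 0 * g 1 1 - g 0 1 * g 1 0 = 1 := by rw [← det_fin_two]; exact g.2
  have hsq : ((g : Matrix (Fin 2) (Fin 2) (ZMod p)) - 1) ^ 2 = 0 := by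
    rw [pow_two]
    ext i j
    fin_cases i <;> fin_cases j <;> simp [Matrix.mul_apply, Fin.sum_univ_two, Matrix.one_apply]
    · linear_combination (g 0 0) * hg - hd
    · linear_combination (g 0 1) * hg
    · linear_combination (g 1 0) * hg
    · linear_combination (g 1 1) * hg - hd
  have hp : ((g : Matrix (Fin 2) (Fin 2) (ZMod p)) - 1) ^ p = 0 :=
    pow_eq_zero_of_le (Fact.out : p.Prime).two_le hsq
  rw [sub_pow_char_of_commute p (Commute.one_right _), one_pow, sub_eq_zero] at hp
  exact Subtype.ext hp

theorem SL2_trace_eq_two_of_pow_char_eq_one {g : SpecialLinearGroup (Fin 2) (ZMod p)}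
    (hg : g ^ p = 1) : g 0 0 + g 1 1 = 2 := by
  have hd : g 0 0 * g 1 1 - g 0 1 * g 1 0 = 1 := by rw [← det_fin_two]; exact g.2
  have h0 : ((g : Matrix (Fin 2) (Fin 2) (ZMod p)) - 1) ^ p = 0 := by
    rw [sub_pow_char_of_commute p (Commute.one_right _), one_pow, sub_eq_zero]
    exact congrArg Subtype.val hg
  have h1 := congrArg Matrix.det h0
  rw [det_pow, det_zero] at h1
  have h2 := eq_zero_of_pow_eq_zero h1
  rw [det_fin_two] at h2
  simp at h2
  linear_combination hd - h2

theorem SL2_eq_one_of_trace_eq_two {K : Subgroup (SpecialLinearGroup (Fin 2) (ZMod p))}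
    (hK : ¬ p ∣ Nat.card K) {g : SpecialLinearGroup (Fin 2) (ZMod p)} (hgK : g ∈ K)
    (hg : g 0 0 + g 1 1 = 2) : g = 1 := by
  by_contra hne
  apply hK
  have := Subgroup.orderOf_dvd_natCard K hgK
  rwa [orderOf_eq_prime (SL2_pow_char_eq_one_of_trace_eq_two hg) hne] at this

/-- The square has trace 2, hence is 1; Cayley–Hamilton then reads 2g = -2. Characteristic 2 is
separate, where -1 = 1. -/
theorem SL2_eq_neg_one_of_trace_eq_neg_two
    {K : Subgroup (SpecialLinearGroup (Fin 2) (ZMod p))}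
    (hK : ¬ p ∣ Nat.card K) {g : SpecialLinearGroup (Fin 2) (ZMod p)} (hgK : g ∈ K)
    (hg : g 0 0 + g 1 1 = -2) : g = -1 := by
  have hd : g 0 0 * g 1 1 - g 0 1 * g 1 0 = 1 := by rw [← det_fin_two]; exact g.2
  have h2 : (g ^ 2) 0 0 + (g ^ 2) 1 1 = 2 := by
    change ((g : Matrix (Fin 2) (Fin 2) (ZMod p)) ^ 2) 0 0 +
      ((g : Matrix (Fin 2) (Fin 2) (ZMod p)) ^ 2) 1 1 = 2
    simp only [pow_two, Matrix.mul_apply, Fin.sum_univ_two]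
    linear_combination (g 0 0 + g 1 1 - 2) * hg - 2 * hd
  have h1 := SL2_eq_one_of_trace_eq_two hK (pow_mem hgK 2) h2
  by_cases hp2 : (2 : ZMod p) = 0
  · have hg1 := SL2_eq_one_of_trace_eq_two hK hgK (by rw [hg, hp2, neg_zero])
    rw [hg1]
    ext i j
    fin_cases i <;> fin_cases j <;> simp <;> linear_combination hp2
  · have hm : (g : Matrix (Fin 2) (Fin 2) (ZMod p)) ^ 2 = 1 := congrArg Subtype.val h1
    rw [pow_two] at hm
    have h00 := congrFun (congrFun hm 0) 0
    have h01 := congrFun (congrFun hm 0) 1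
    have h10 := congrFun (congrFun hm 1) 0
    have h11 := congrFun (congrFun hm 1) 1
    simp [Matrix.mul_apply, Fin.sum_univ_two] at h00 h01 h10 h11
    ext i j
    fin_cases i <;> fin_cases j <;> simp <;> apply mul_left_cancel₀ hp2
    · linear_combination g 0 0 * hg - h00 - hd
    · linear_combination g 0 1 * hg - h01
    · linear_combination g 1 0 * hg - h10
    · linear_combination g 1 1 * hg - h11 - hd

theorem SL2_disc_ne_zero {K : Subgroup (SpecialLinearGroup (Fin 2) (ZMod p))}
    (hK : ¬ p ∣ Nat.card K) {g : SpecialLinearGroup (Fin 2) (ZMod p)} (hgK : g ∈ K)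
    (h1 : g ≠ 1) (h2 : g ≠ -1) : (g 0 0 - g 1 1) ^ 2 + 4 * (g 0 1 * g 1 0) ≠ 0 := by
  intro h
  have hd : g 0 0 * g 1 1 - g 0 1 * g 1 0 = 1 := by rw [← det_fin_two]; exact g.2
  -- For determinant 1 the discriminant is the squared trace minus 4.
  have h' : (g 0 0 + g 1 1 - 2) * (g 0 0 + g 1 1 + 2) = 0 := by linear_combination h + 4 * hd
  rcases mul_eq_zero.1 h' with h' | h'
  · exact h1 (SL2_eq_one_of_trace_eq_two hK hgK (by linear_combination h'))
  · exact h2 (SL2_eq_neg_one_of_trace_eq_neg_two hK hgK (by linear_combination h'))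

/-- The eigenvalue is a character into a field. It is faithful: eigenvalue 1 with determinant 1
means trace 2, hence the identity. Finite groups embedded in a field's multiplicative monoid are
cyclic. -/
theorem SL2_isCyclic_of_eigenvector {F : Type*} [Field F] [Algebra (ZMod p) F]
    {S : Subgroup (SpecialLinearGroup (Fin 2) (ZMod p))} (hS : ¬ p ∣ Nat.card S)
    {v : Fin 2 → F} {i : Fin 2} (hv : v i = 1) (χ : S → F)
    (hχ : ∀ g : S, (g.1.1.map (algebraMap (ZMod p) F)) *ᵥ v = χ g • v) : IsCyclic S := by
  have hval : ∀ {a b : F}, a • v = b • v → a = b := fun h => by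
    have := congrFun h i
    simpa [hv] using this
  have h1 : χ 1 = 1 := hval (by rw [← hχ]; simp)
  have hmul : ∀ g h, χ (g * h) = χ g * χ h := fun g h => hval (by
    have hgh : (g * h).1.1 = g.1.1 * h.1.1 := rfl
    rw [← hχ, hgh, Matrix.map_mul, ← mulVec_mulVec, hχ, mulVec_smul, hχ, smul_smul, mul_comm])
  let f : S →* F := ⟨⟨χ, h1⟩, hmul⟩
  refine isCyclic_of_injective_ringHom f ((injective_iff_map_eq_one f).2 fun g hg => ?_)
  have hg' : χ g = 1 := hg
  have hgv := hχ g
  rw [hg', one_smul] at hgv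
  have hdet : ((g.1.1 - 1).map (algebraMap (ZMod p) F)).det = 0 := by
    refine exists_mulVec_eq_zero_iff.1 ⟨v, fun h => ?_, ?_⟩
    · rw [h] at hv; simp at hv
    · rw [Matrix.map_sub _ (map_sub _), sub_mulVec, hgv, Matrix.map_one _ (map_zero _) (map_one _),
        one_mulVec, sub_self]
  rw [← RingHom.mapMatrix_apply, ← RingHom.map_det, map_eq_zero, det_fin_two] at hdet
  have hd : g.1 0 0 * g.1 1 1 - g.1 0 1 * g.1 1 0 = 1 := by rw [← det_fin_two]; exact g.1.2
  simp at hdet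
  exact Subtype.ext (SL2_eq_one_of_trace_eq_two hS g.2 (by linear_combination hd - hdet))

open Classical in
/-- The action of `SL₂(p)` on the projective line over the field with `p ^ 2` elements. -/
noncomputable def mobiusHom (p : ℕ) [Fact p.Prime] :
    SpecialLinearGroup (Fin 2) (ZMod p) →* Equiv.Perm (OnePoint (GaloisField p 2)) :=
  (toPermHom (GL (Fin 2) (GaloisField p 2)) (OnePoint (GaloisField p 2))).comp
    ((GeneralLinearGroup.map (algebraMap (ZMod p) (GaloisField p 2))).comp
      SpecialLinearGroup.toGL)

theorem mobiusHom_infty (g : SpecialLinearGroup (Fin 2) (ZMod p)) :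
    mobiusHom p g OnePoint.infty = OnePoint.infty ↔ g 1 0 = 0 := by
  classical
  have : mobiusHom p g OnePoint.infty =
    (GeneralLinearGroup.map (algebraMap (ZMod p) (GaloisField p 2))
      (SpecialLinearGroup.toGL g)) • (OnePoint.infty : OnePoint (GaloisField p 2)) := by
    simp [mobiusHom]
  rw [this, OnePoint.smul_infty_eq_self_iff]
  simp

theorem mobiusHom_coe (g : SpecialLinearGroup (Fin 2) (ZMod p)) (x : GaloisField p 2) :
    mobiusHom p g x = x ↔ algebraMap _ (GaloisField p 2) (g 1 0) * x ^ 2 +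
      algebraMap _ (GaloisField p 2) (g 1 1 - g 0 0) * x -
      algebraMap _ (GaloisField p 2) (g 0 1) = 0 := by
  classical
  have : mobiusHom p g x =
    (GeneralLinearGroup.map (algebraMap (ZMod p) (GaloisField p 2))
      (SpecialLinearGroup.toGL g)) • (x : OnePoint (GaloisField p 2)) := by
    simp [mobiusHom]
  rw [this, ← GeneralLinearGroup.fixpointPolynomial_aeval_eq_zero_iff]
  simp [GeneralLinearGroup.fixpointPolynomial]

/-- Fixing ∞, 0 and 1 already makes the matrix scalar. -/
theorem mobiusHom_ker_le_center :
    (mobiusHom p).ker ≤ Subgroup.center (SpecialLinearGroup (Fin 2) (ZMod p)) := by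
  intro g hg
  rw [MonoidHom.mem_ker] at hg
  have hd : g 0 0 * g 1 1 - g 0 1 * g 1 0 = 1 := by rw [← det_fin_two]; exact g.2
  have hc : g 1 0 = 0 := (mobiusHom_infty g).1 (by rw [hg]; rfl)
  have h0 := (mobiusHom_coe g 0).1 (by rw [hg]; rfl)
  have hb : g 0 1 = 0 := by simpa using h0
  have h1 := (mobiusHom_coe g 1).1 (by rw [hg]; rfl)
  rw [hc, hb, map_zero, mul_one, zero_mul, zero_add, sub_zero, map_eq_zero, sub_eq_zero] at h1
  rw [Matrix.SpecialLinearGroup.mem_center_iff]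
  refine ⟨g 0 0, ?_, ?_⟩
  · rw [Fintype.card_fin]
    linear_combination hd - g 0 0 * h1 + g 0 1 * hc
  · ext i j
    fin_cases i <;> fin_cases j <;> simp [hc, hb, h1]

theorem mobiusHom_neg_one : mobiusHom p (-1) = 1 := by
  ext x
  cases x with
  | infty => exact (mobiusHom_infty _).2 (by simp)
  | coe x => exact (mobiusHom_coe _ x).2 (by simp)

theorem card_fixedBy_mobiusHom {K : Subgroup (SpecialLinearGroup (Fin 2) (ZMod p))}
    (hK : ¬ p ∣ Nat.card K) {g : SpecialLinearGroup (Fin 2) (ZMod p)} (hgK : g ∈ K)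
    (hg : mobiusHom p g ≠ 1) :
    Nat.card (fixedBy (OnePoint (GaloisField p 2)) (mobiusHom p g)) = 2 := by
  classical
  have hdisc := SL2_disc_ne_zero hK hgK (by rintro rfl; exact hg (map_one _))
    (by rintro rfl; exact hg mobiusHom_neg_one)
  have key := card_fixedBy_onePoint_eq_two
    (GeneralLinearGroup.map (algebraMap (ZMod p) (GaloisField p 2))
      (SpecialLinearGroup.toGL g)) ?_ ?_
  · refine Eq.trans ?_ key
    simp [mobiusHom, fixedBy]
  · have := (map_ne_zero (algebraMap (ZMod p) (GaloisField p 2))).2 hdisc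
    simpa [map_ofNat] using this
  · intro hc
    have hc' : g 1 0 ≠ 0 := by
      intro h
      exact hc (by simp [h])
    obtain ⟨x, hx⟩ := exists_root_quadratic_galoisField p (b := g 1 1 - g 0 0) (c := - g 0 1) hc'
    exact ⟨x, by simpa [sub_eq_add_neg] using hx⟩

theorem isCyclic_inf_stabilizer_mobiusHom
    {K : Subgroup (SpecialLinearGroup (Fin 2) (ZMod p))} (hK : ¬ p ∣ Nat.card K)
    (y : OnePoint (GaloisField p 2)) :
    IsCyclic (K ⊓ (stabilizer (Equiv.Perm (OnePoint (GaloisField p 2))) y).comap (mobiusHom p) :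
      Subgroup (SpecialLinearGroup (Fin 2) (ZMod p))) := by
  have hS : ¬ p ∣ Nat.card (K ⊓ (stabilizer (Equiv.Perm (OnePoint (GaloisField p 2))) y).comap
      (mobiusHom p) : Subgroup (SpecialLinearGroup (Fin 2) (ZMod p))) := fun h =>
    hK (h.trans (Subgroup.card_dvd_of_le inf_le_left))
  cases y with
  | infty =>
    refine SL2_isCyclic_of_eigenvector hS (v := ![(1 : GaloisField p 2), 0]) (i := 0) rfl
      (fun g => algebraMap _ _ (g.1 0 0)) fun g => ?_
    have hg := (mobiusHom_infty g.1).1 g.2.2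
    ext i
    fin_cases i <;> simp [mulVec, dotProduct, Fin.sum_univ_two, hg]
  | coe x =>
    refine SL2_isCyclic_of_eigenvector hS (v := ![x, 1]) (i := 1) rfl
      (fun g => algebraMap _ _ (g.1 1 0) * x + algebraMap _ _ (g.1 1 1)) fun g => ?_
    have hg := (mobiusHom_coe g.1 x).1 g.2.2
    rw [map_sub] at hg
    ext i
    fin_cases i <;> simp [mulVec, dotProduct, Fin.sum_univ_two]
    linear_combination - hg

theorem SL2_two_generated_of_not_dvd {K : Subgroup (SpecialLinearGroup (Fin 2) (ZMod p))}
    (hK : ¬ p ∣ Nat.card K) : ∃ a ∈ K, ∃ b ∈ K, K ≤ Subgroup.closure {a, b} ⊔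
      Subgroup.center (SpecialLinearGroup (Fin 2) (ZMod p)) := by
  have : Finite (OnePoint (GaloisField p 2)) := inferInstanceAs (Finite (Option _))
  have hfix : ∀ q : K.map (mobiusHom p), q ≠ 1 →
      Nat.card (fixedBy (OnePoint (GaloisField p 2)) q) = 2 := by
    rintro ⟨_, g, hg, rfl⟩ hq
    exact card_fixedBy_mobiusHom hK hg fun h => hq (Subtype.ext h)
  have hcyc : ∀ x : OnePoint (GaloisField p 2),
      IsCyclic (stabilizer (K.map (mobiusHom p)) x) := by
    intro x
    have := isCyclic_inf_stabilizer_mobiusHom hK x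
    let f : (K ⊓ (stabilizer (Equiv.Perm (OnePoint (GaloisField p 2))) x).comap (mobiusHom p) :
        Subgroup (SpecialLinearGroup (Fin 2) (ZMod p))) →*
        stabilizer (K.map (mobiusHom p)) x :=
      { toFun g := ⟨⟨mobiusHom p g, Subgroup.mem_map_of_mem _ g.2.1⟩, g.2.2⟩
        map_one' := Subtype.ext (Subtype.ext (map_one (mobiusHom p)))
        map_mul' g h := Subtype.ext (Subtype.ext (map_mul (mobiusHom p) g.1 h.1)) }
    refine isCyclic_of_surjective f ?_
    rintro ⟨⟨_, g, hg, rfl⟩, hx⟩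
    exact ⟨⟨g, hg, hx⟩, rfl⟩
  obtain ⟨⟨_, a, ha, rfl⟩, ⟨_, b, hb, rfl⟩, hab⟩ :=
    exists_closure_pair_eq_top_of_card_fixedBy_eq_two hfix hcyc
  refine ⟨a, ha, b, hb, ?_⟩
  refine le_trans ?_ (sup_le_sup_left mobiusHom_ker_le_center _)
  rw [← Subgroup.map_le_map_iff, MonoidHom.map_closure, Set.image_pair]
  have := congrArg (Subgroup.map (K.map (mobiusHom p)).subtype) hab
  rw [MonoidHom.map_closure, Set.image_pair, ← MonoidHom.range_eq_map,
    Subgroup.range_subtype] at this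
  exact this.ge

/-! ### Subgroups of SL₂(p) of order divisible by p -/

/-- Upper unitriangular matrices in `SL₂(p)`. -/
def upperUnipotent (t : ZMod p) : SpecialLinearGroup (Fin 2) (ZMod p) :=
  ⟨!![1, t; 0, 1], by simp⟩

/-- Lower unitriangular matrices in `SL₂(p)`. -/
def lowerUnipotent (t : ZMod p) : SpecialLinearGroup (Fin 2) (ZMod p) :=
  ⟨!![1, 0; t, 1], by simp⟩

@[simp]
theorem coe_upperUnipotent (t : ZMod p) :
    (upperUnipotent t : Matrix (Fin 2) (Fin 2) (ZMod p)) = !![1, t; 0, 1] := rfl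

@[simp]
theorem coe_lowerUnipotent (t : ZMod p) :
    (lowerUnipotent t : Matrix (Fin 2) (Fin 2) (ZMod p)) = !![1, 0; t, 1] := rfl

theorem upperUnipotent_add (s t : ZMod p) :
    upperUnipotent (s + t) = upperUnipotent s * upperUnipotent t := by
  ext i j
  fin_cases i <;> fin_cases j <;> simp [add_comm]

theorem upperUnipotent_pow (t : ZMod p) (n : ℕ) :
    upperUnipotent t ^ n = upperUnipotent ((n : ZMod p) * t) := by
  induction n with
  | zero =>
    ext i j
    fin_cases i <;> fin_cases j <;> simp
  | succ n ih => rw [pow_succ, ih, ← upperUnipotent_add]; congr 1; push_cast; ring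

theorem upperUnipotent_mem {K : Subgroup (SpecialLinearGroup (Fin 2) (ZMod p))} {t : ZMod p}
    (ht : t ≠ 0) (hK : upperUnipotent t ∈ K) (s : ZMod p) : upperUnipotent s ∈ K := by
  have := pow_mem hK (s / t).val
  rwa [upperUnipotent_pow, ZMod.natCast_zmod_val, div_mul_cancel₀ _ ht] at this

theorem SL2_eq_upper_mul_lower_mul_upper (g : SpecialLinearGroup (Fin 2) (ZMod p))
    (hc : g 1 0 ≠ 0) : g = upperUnipotent ((g 0 0 - 1) / g 1 0) * lowerUnipotent (g 1 0) *
      upperUnipotent ((g 1 1 - 1) / g 1 0) := by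
  have hd : g 0 0 * g 1 1 - g 0 1 * g 1 0 = 1 := by rw [← det_fin_two]; exact g.2
  ext i j
  fin_cases i <;> fin_cases j <;> simp <;> field_simp <;>
    first | ring1 | linear_combination hd | linear_combination -hd

/-- By the big-cell factorisation of k, K contains a nontrivial lower unipotent besides all upper
ones; together they generate everything. -/
theorem eq_top_of_upperUnipotent_mem {K : Subgroup (SpecialLinearGroup (Fin 2) (ZMod p))}
    {t : ZMod p} (ht : t ≠ 0) (htK : upperUnipotent t ∈ K)
    {k : SpecialLinearGroup (Fin 2) (ZMod p)} (hk : k ∈ K) (hc : k 1 0 ≠ 0) : K = ⊤ := by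
  have hU := upperUnipotent_mem ht htK
  have hlc : lowerUnipotent (k 1 0) ∈ K := by
    have h := SL2_eq_upper_mul_lower_mul_upper k hc
    rw [h, K.mul_mem_cancel_right (hU _), K.mul_mem_cancel_left (hU _)] at hk
    exact hk
  have hL : ∀ s, lowerUnipotent s ∈ K := by
    -- This product is antidiagonal, a Weyl element, so it conjugates upper unipotents to lower
    -- ones.
    set w : SpecialLinearGroup (Fin 2) (ZMod p) := upperUnipotent (-(k 1 0)⁻¹) *
      lowerUnipotent (k 1 0) * upperUnipotent (-(k 1 0)⁻¹) with hw
    have hwK : w ∈ K := mul_mem (mul_mem (hU _) hlc) (hU _)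
    intro s
    have : lowerUnipotent s * w = w * upperUnipotent (-s / k 1 0 ^ 2) := by
      rw [hw]
      ext i j
      fin_cases i <;> fin_cases j <;> simp [hc] <;>
        field_simp
    rw [← K.mul_mem_cancel_right hwK, this]
    exact mul_mem hwK (hU _)
  have hne : ∀ g : SpecialLinearGroup (Fin 2) (ZMod p), g 1 0 ≠ 0 → g ∈ K := fun g hg => by
    rw [SL2_eq_upper_mul_lower_mul_upper g hg]
    exact mul_mem (mul_mem (hU _) (hL _)) (hU _)
  rw [Subgroup.eq_top_iff']
  intro g
  by_cases hg : g 1 0 = 0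
  · rw [← K.mul_mem_cancel_left (hL 1)]
    apply hne
    have hd : g 0 0 * g 1 1 - g 0 1 * g 1 0 = 1 := by rw [← det_fin_two]; exact g.2
    intro h
    have h0 : g 0 0 = 0 := by simpa [hg, vecMul, dotProduct, Fin.sum_univ_two] using h
    rw [h0, hg] at hd
    simp at hd
  · exact hne g hg

/-- The top-left entry is a character with cyclic image; b lifts a generator of that image, and the
kernel is unipotent, hence covered by powers of `upperUnipotent t`. -/
theorem SL2_two_generated_of_upperTriangular
    {K : Subgroup (SpecialLinearGroup (Fin 2) (ZMod p))} {t : ZMod p} (ht : t ≠ 0)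
    (hK : ∀ k ∈ K, k 1 0 = 0) :
    ∃ b ∈ K, K ≤ Subgroup.closure {upperUnipotent t, b} := by
  let χ : K →* ZMod p :=
    { toFun k := k.1 0 0
      map_one' := by simp
      map_mul' k l := by simp [Matrix.mul_apply, Fin.sum_univ_two, hK l.1 l.2] }
  obtain ⟨⟨_, k, rfl⟩, hk⟩ := IsCyclic.exists_generator (α := χ.toHomUnits.range)
  refine ⟨k, k.2, fun l hl => ?_⟩
  obtain ⟨i, hi⟩ := Subgroup.mem_zpowers_iff.1 (hk ⟨_, ⟨l, hl⟩, rfl⟩)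
  have hi' : χ.toHomUnits (k ^ i) = χ.toHomUnits ⟨l, hl⟩ := by
    rw [map_zpow]; exact congrArg Subtype.val hi
  set m : K := (k ^ i)⁻¹ * ⟨l, hl⟩ with hm
  have hm1 : χ.toHomUnits m = 1 := by rw [hm, map_mul, map_inv, hi', inv_mul_cancel]
  have hm00 : m.1 0 0 = 1 := congrArg Units.val hm1
  have hm10 := hK m m.2
  have hd : m.1 0 0 * m.1 1 1 - m.1 0 1 * m.1 1 0 = 1 := by rw [← det_fin_two]; exact m.1.2
  have hmU : m.1 = upperUnipotent (m.1 0 1) := by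
    rw [hm00, hm10] at hd
    ext i j
    fin_cases i <;> fin_cases j <;> simp [hm00, hm10]
    linear_combination hd
  have hl' : l = k.1 ^ i * m.1 := by
    simp [hm]
  rw [hl']
  refine mul_mem (zpow_mem (Subgroup.subset_closure (by simp)) i) ?_
  rw [hmU]
  exact upperUnipotent_mem ht (Subgroup.subset_closure (by simp)) _

theorem exists_conj_upperUnipotent {u : SpecialLinearGroup (Fin 2) (ZMod p)} (hu1 : u ≠ 1)
    (hu : u 0 0 + u 1 1 = 2) : ∃ g : SpecialLinearGroup (Fin 2) (ZMod p), ∃ t : ZMod p,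
      t ≠ 0 ∧ u * g = g * upperUnipotent t := by
  have hd : u 0 0 * u 1 1 - u 0 1 * u 1 0 = 1 := by rw [← det_fin_two]; exact u.2
  by_cases hc : u 1 0 = 0
  · have ha : u 0 0 = 1 := by
      have : (u 0 0 - 1) ^ 2 = 0 := by
        linear_combination u 0 0 * hu - hd - u 0 1 * hc
      have := eq_zero_of_pow_eq_zero this
      linear_combination this
    have hdd : u 1 1 = 1 := by linear_combination hu - ha
    refine ⟨1, u 0 1, fun hb => hu1 ?_, ?_⟩
    · ext i j
      fin_cases i <;> fin_cases j <;> simp [ha, hb, hc, hdd]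
    · ext i j
      fin_cases i <;> fin_cases j <;> simp [ha, hc, hdd]
  -- The first column is (u - 1)e₁, fixed by u because (u - 1)² = 0; the second is the multiple of
  -- e₁ that makes the determinant 1.
  · obtain ⟨g, hg⟩ : ∃ g : SpecialLinearGroup (Fin 2) (ZMod p),
        (g : Matrix (Fin 2) (Fin 2) (ZMod p)) = !![u 0 0 - 1, -(u 1 0)⁻¹; u 1 0, 0] :=
      ⟨⟨_, by simp [hc]⟩, rfl⟩
    refine ⟨g, -(u 1 0)⁻¹, by simpa using hc, ?_⟩
    ext i j
    fin_cases i <;> fin_cases j <;>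
      simp [Matrix.mul_apply, Fin.sum_univ_two, hg, hc]
    · linear_combination u 0 0 * hu - hd
    · field_simp
      ring
    · linear_combination u 1 0 * hu

theorem SL2_two_generated_of_dvd {K : Subgroup (SpecialLinearGroup (Fin 2) (ZMod p))}
    (hK : p ∣ Nat.card K) : ∃ a ∈ K, ∃ b ∈ K, K ≤ Subgroup.closure {a, b} := by
  obtain ⟨u, hu⟩ := exists_prime_orderOf_dvd_card' p hK
  have hup : u.1 ^ p = 1 := by
    have := pow_orderOf_eq_one u
    rw [hu] at this
    exact congrArg Subtype.val this
  have hu1 : u.1 ≠ 1 := by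
    intro h
    rw [OneMemClass.coe_eq_one] at h
    rw [h, orderOf_one] at hu
    exact (Fact.out : p.Prime).one_lt.ne hu
  obtain ⟨g, t, ht, hg⟩ := exists_conj_upperUnipotent hu1 (SL2_trace_eq_two_of_pow_char_eq_one hup)
  have hconj : MulAut.conj g (upperUnipotent t) = u := by
    rw [MulAut.conj_apply, ← hg, mul_inv_cancel_right]
  have hbK : ∃ b, MulAut.conj g b ∈ K ∧ K.comap (MulAut.conj g).toMonoidHom ≤
      Subgroup.closure {upperUnipotent t, b} := by
    by_cases h : ∀ k ∈ K.comap (MulAut.conj g).toMonoidHom, k 1 0 = 0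
    · exact SL2_two_generated_of_upperTriangular ht h
    · push Not at h
      obtain ⟨k, hk, hk0⟩ := h
      refine ⟨k, hk, ?_⟩
      rw [eq_top_of_upperUnipotent_mem (K := Subgroup.closure {upperUnipotent t, k}) ht
        (Subgroup.subset_closure (by simp)) (Subgroup.subset_closure (by simp)) hk0]
      exact le_top
  obtain ⟨b, hb, hle⟩ := hbK
  refine ⟨u, u.2, MulAut.conj g b, hb, ?_⟩
  have := Subgroup.map_mono (f := (MulAut.conj g).toMonoidHom) hle
  rw [Subgroup.map_comap_eq_self_of_surjective (MulAut.conj g).surjective,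
    MonoidHom.map_closure, Set.image_pair] at this
  rw [← hconj]
  exact this

theorem PSL2_subgroup_two_generated
    (M : Subgroup (ProjectiveSpecialLinearGroup (Fin 2) (ZMod p))) :
    ∃ a b, Subgroup.closure {a, b} = M := by
  set π := QuotientGroup.mk' (Subgroup.center (SpecialLinearGroup (Fin 2) (ZMod p))) with hπ
  have key : ∃ a ∈ M.comap π, ∃ b ∈ M.comap π, M.comap π ≤ Subgroup.closure {a, b} ⊔
      Subgroup.center (SpecialLinearGroup (Fin 2) (ZMod p)) := by
    by_cases h : p ∣ Nat.card (M.comap π)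
    · obtain ⟨a, ha, b, hb, hle⟩ := SL2_two_generated_of_dvd h
      exact ⟨a, ha, b, hb, hle.trans le_sup_left⟩
    · exact SL2_two_generated_of_not_dvd h
  obtain ⟨a, ha, b, hb, hle⟩ := key
  refine ⟨π a, π b, le_antisymm ?_ ?_⟩
  · rw [Subgroup.closure_le]
    exact Set.insert_subset ha (Set.singleton_subset_iff.2 hb)
  · have := Subgroup.map_mono (f := π) hle
    rw [Subgroup.map_comap_eq_self_of_surjective (QuotientGroup.mk'_surjective _),
      Subgroup.map_sup, MonoidHom.map_closure, Set.image_pair] at this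
    refine this.trans (sup_le le_rfl ?_)
    rw [Subgroup.map_le_iff_le_comap]
    intro z hz
    rw [Subgroup.mem_comap, show π z = 1 from (QuotientGroup.eq_one_iff z).2 hz]
    exact one_mem _

end SL2

/-! ### From generators inside maximal subgroups to bounds on `psi` -/

namespace GeneratorSubstitution

theorem MEquiv.mEquivR {G : Type*} [Group G] [Finite G] {x y : G} (h : MEquiv x y) (r : ℕ) :
    MEquivR r x y := fun _ => ⟨h.closure_insert_eq_top, h.symm.closure_insert_eq_top⟩

theorem psi_le_of_forall_exists {G : Type*} [Group G] [Finite G] {r : ℕ} (hr : 0 < r)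
    (h : ∀ M : Subgroup G, IsCoatom M → ∀ x ∉ M, ∃ z : Fin (r - 1) → G, Set.range z ⊆ M ∧
      Subgroup.closure (insert x (Set.range z)) = ⊤) : psi G ≤ r := by
  have key : ∀ x y : G, MEquivR r x y → ∀ M : Subgroup G, IsCoatom M → y ∈ M → x ∈ M := by
    intro x y hxy M hM hy
    by_contra hx
    obtain ⟨z, hz, htop⟩ := h M hM x hx
    have h1 := (hxy z).1 htop
    have h2 : Subgroup.closure (insert y (Set.range z)) ≤ M := by
      rw [Subgroup.closure_le]
      exact Set.insert_subset hy hz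
    rw [h1] at h2
    exact hM.1 (top_le_iff.1 h2)
  exact (psi_isLeast G).2 ⟨hr, fun x y => ⟨fun hxy M hM =>
    ⟨key y x (fun z => (hxy z).symm) M hM, key x y hxy M hM⟩, fun hxy => hxy.mEquivR r⟩⟩

theorem closure_insert_coatom_eq_top {G : Type*} [Group G] {M : Subgroup G} (hM : IsCoatom M)
    {x : G} (hx : x ∉ M) {Z : Set G} (hZ : Subgroup.closure Z = M) :
    Subgroup.closure (insert x Z) = ⊤ := by
  refine hM.2 _ (lt_of_le_of_ne ?_ ?_)
  · rw [← hZ]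
    exact Subgroup.closure_mono (Set.subset_insert x Z)
  · intro h
    exact hx (h ▸ Subgroup.subset_closure (Set.mem_insert x Z))

theorem exists_range_subset_of_ncard_le {G : Type*} [Group G] [Finite G] {Z : Set G} {n : ℕ}
    (hZ : Z.ncard ≤ n) : ∃ z : Fin n → G, Z ⊆ Set.range z ∧ Set.range z ⊆ insert 1 Z := by
  classical
  obtain ⟨e⟩ : Nonempty (Z ↪ Fin n) := by
    have := Fintype.ofFinite Z
    rw [← Nat.card_coe_set_eq, Nat.card_eq_fintype_card] at hZ
    exact Function.Embedding.nonempty_of_card_le (by simpa using hZ)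
  -- Unused positions are padded with 1, which lies in every subgroup and does not affect
  -- generation.
  refine ⟨fun i => if h : ∃ a : Z, e a = i then (h.choose : G) else 1, ?_, ?_⟩
  · intro a ha
    have h : ∃ b : Z, e b = e ⟨a, ha⟩ := ⟨_, rfl⟩
    refine ⟨e ⟨a, ha⟩, ?_⟩
    simp only [dif_pos h, e.injective h.choose_spec]
  · rintro _ ⟨i, rfl⟩
    dsimp only
    split_ifs with h
    · exact Set.mem_insert_of_mem _ h.choose.2
    · exact Set.mem_insert _ _

theorem psi_le_mu (G : Type*) [Group G] [Finite G] [Nontrivial G] : psi G ≤ mu G := by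
  have hmu : 0 < mu G := by
    obtain ⟨S, hS, hn⟩ := (mu_isGreatest G).1
    rw [← hn, Set.ncard_pos]
    by_contra h
    rw [Set.not_nonempty_iff_eq_empty] at h
    have := hS.1
    rw [h, Subgroup.closure_empty] at this
    exact bot_ne_top this
  refine psi_le_of_forall_exists hmu fun M hM x hx => ?_
  obtain ⟨Z, hZ⟩ := (Set.toFinite
      {Z : Set G | Z ⊆ M ∧ Subgroup.closure (insert x Z) = ⊤}).exists_minimal
    ⟨M, subset_rfl, closure_insert_coatom_eq_top hM hx (Subgroup.closure_eq M)⟩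
  have hxZ : x ∉ Z := fun h => hx (hZ.1.1 h)
  have hmin : IsMinimalGeneratingSet (insert x Z) := by
    refine ⟨hZ.1.2, fun T hT hTtop => ?_⟩
    by_cases hxT : x ∈ T
    · have hT' : insert x (T \ {x}) = T := by
        rw [Set.insert_sdiff_singleton, Set.insert_eq_of_mem hxT]
      have hTZ : T \ {x} ⊆ Z := by
        rintro a ⟨ha, hax⟩
        exact (hT.1 ha).resolve_left hax
      have := hZ.2 ⟨hTZ.trans hZ.1.1, by rw [hT', hTtop]⟩ hTZ
      apply hT.2
      rw [← hT']
      exact Set.insert_subset_insert this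
    · have : Subgroup.closure T ≤ M := by
        rw [Subgroup.closure_le]
        intro a ha
        refine hZ.1.1 ((hT.1 ha).resolve_left ?_)
        rintro rfl
        exact hxT ha
      rw [hTtop] at this
      exact hM.1 (top_le_iff.1 this)
  have hcard : Z.ncard ≤ mu G - 1 := by
    have := (mu_isGreatest G).2 ⟨_, hmin, rfl⟩
    rw [Set.ncard_insert_of_notMem hxZ] at this
    omega
  obtain ⟨z, hz1, hz2⟩ := exists_range_subset_of_ncard_le hcard
  refine ⟨z, hz2.trans (Set.insert_subset M.one_mem hZ.1.1), top_le_iff.1 ?_⟩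
  rw [← hZ.1.2]
  exact Subgroup.closure_mono (Set.insert_subset_insert hz1)

theorem psi_le_three_of_two_generated {G : Type*} [Group G] [Finite G]
    (h : ∀ M : Subgroup G, IsCoatom M → ∃ a b, Subgroup.closure {a, b} = M) : psi G ≤ 3 := by
  refine psi_le_of_forall_exists three_pos fun M hM x hx => ?_
  obtain ⟨a, b, hab⟩ := h M hM
  have hr : Set.range (![a, b] : Fin (3 - 1) → G) = {a, b} := by
    exact Matrix.range_cons_cons_empty a b _
  refine ⟨![a, b], ?_, ?_⟩
  · rw [hr, ← hab]
    exact Subgroup.subset_closure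
  · rw [hr]
    exact closure_insert_coatom_eq_top hM hx hab

end GeneratorSubstitution

theorem mainTheorem6 :
    (∀ (G : Type*) [Group G] [Finite G] [Nontrivial G],
      GeneratorSubstitution.psi G ≤ GeneratorSubstitution.mu G) ∧
    (∀ (p : ℕ) [Fact p.Prime],
      (p ∉ ({7, 11, 19, 31} : Set ℕ) →
        GeneratorSubstitution.psi (Matrix.ProjectiveSpecialLinearGroup (Fin 2) (ZMod p)) ≤ 3) ∧
      (p ∈ ({7, 11, 19, 31} : Set ℕ) →
        GeneratorSubstitution.psi (Matrix.ProjectiveSpecialLinearGroup (Fin 2) (ZMod p)) ≤ 4)) := by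
  refine ⟨fun G _ _ _ => GeneratorSubstitution.psi_le_mu G, fun p _ => ?_⟩
  have h3 : GeneratorSubstitution.psi
      (Matrix.ProjectiveSpecialLinearGroup (Fin 2) (ZMod p)) ≤ 3 :=
    GeneratorSubstitution.psi_le_three_of_two_generated fun M _ => PSL2_subgroup_two_generated M
  exact ⟨fun _ => h3, fun _ => h3.trans (by norm_num)⟩
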